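/- Let $k$ be a field with $\operatorname{char} k\neq 2,3$, let $\Gamma$ be a commutative group, and let $\varepsilon:\Gamma\times\Gamma\to k\setminus\{0\}$ be a commutation factor, i.e. $\varepsilon(\alpha+\beta,\gamma)=\varepsilon(\alpha,\gamma)\varepsilon(\beta,\gamma)$, $\varepsilon(\alpha,\beta+\gamma)=\varepsilon(\alpha,\beta)\varepsilon(\alpha,\gamma)$ and $\varepsilon(\alpha,\beta)\varepsilon(\beta,\alpha)=1$ for all $\alpha,\beta,\gamma\in\Gamma$. A color Lie algebra is a $\Gamma$-graded vector space $g=\bigoplus_{\gamma}g_\gamma$ over $k$ with a bilinear bracket such that $\langle g_\alpha,g_\beta\rangle\subseteq g_{\alpha+\beta}$, $\langle a,b\rangle=-\varepsilon(\alpha,\beta)\langle b,a\rangle$ and $$\varepsilon(\gamma,\alpha)\langle a,\langle b,c\rangle\rangle+\varepsilon(\beta,\gamma)\langle c,\langle a,b\rangle\rangle+\varepsilon(\alpha,\beta)\langle b,\langle c,a\rangle\rangle=0$$ for all $a\in g_\alpha$, $b\in g_\beta$, $c\in g_\gamma$. It is abelian if its bracket is zero. Its universal enveloping algebra $U(g)$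 is the quotient of the tensor algebra $T(g)$ by the two-sided ideal generated by the elements $ab-\varepsilon(\alpha,\beta)ba-\langle a,b\rangle$ with $a\in g_\alpha$, $b\in g_\beta$; it is augmented by the algebra homomorphism $U(g)\to k$ that sends $g$ to $0$. The homology of $g$ (with trivial coefficients) is $H_i(g)=\operatorname{Tor}_i^{U(g)}(k,k)$, $i\ge 0$. Let $g$ be an $n$-dimensional abelian color Lie algebra with a basis $v_1,\dots,v_n$ of homogeneous elements, $v_i\in g_{d_i}$, and let $q$ be the number of indices $i$ with $\varepsilon(d_i,d_i)=-1$ (that is, the number of generators $v_i$ whose square is a defining relation of $U(g)$). Then every $H_i(g)$ is finite-dimensional and $$\sum_{i=0}^\infty z^i\dim_k H_i(g)=\frac{(1+z)^{n-q}}{(1-z)^q}$$ as formal power series. In particular, the total homology $\bigoplus_{i\ge 0}H_i(g)$ is finite-dimensional if and only if $q=0$. -/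

import Mathlib

open CategoryTheory
open scoped TensorProduct ModuleCat

universe u v w

noncomputable section

/-! ### Color Lie algebras -/

/-- A commutation factor on the commutative group `Γ` with values in `k ∖ {0}`. -/
structure CommutationFactor (k : Type u) [Field k] (Γ : Type v) [AddCommGroup Γ] where
  toFun : Γ → Γ → kˣ
  add_left : ∀ α β γ, toFun (α + β) γ = toFun α γ * toFun β γ
  add_right : ∀ α β γ, toFun α (β + γ) = toFun α β * toFun α γ
  mul_swap : ∀ α β, toFun α β * toFun β α = 1

/-- The value `ε(α, β)`, as an element of the field `k`. -/
def CommutationFactor.val {k : Type u} [Field k] {Γ : Type v} [AddCommGroup Γ]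
    (ε : CommutationFactor k Γ) (α β : Γ) : k :=
  (ε.toFun α β : k)

open Classical in
/-- A color Lie algebra (a `Γ`-graded `ε`-Lie algebra) structure on the vector space `g`. -/
structure ColorLieAlgebra {k : Type u} [Field k] {Γ : Type v} [AddCommGroup Γ]
    (ε : CommutationFactor k Γ) (g : Type w) [AddCommGroup g] [Module k g] where
  /-- The homogeneous components. -/
  component : Γ → Submodule k g
  /-- `g` is the direct sum of its homogeneous components. -/
  isInternal : DirectSum.IsInternal component
  /-- The bilinear bracket. -/
  bracket : g →ₗ[k] g →ₗ[k] g
  bracket_mem : ∀ (α β : Γ), ∀ a ∈ component α, ∀ b ∈ component β,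
    bracket a b ∈ component (α + β)
  skew : ∀ (α β : Γ), ∀ a ∈ component α, ∀ b ∈ component β,
    bracket a b = -(ε.val α β • bracket b a)
  jacobi : ∀ (α β γ : Γ), ∀ a ∈ component α, ∀ b ∈ component β, ∀ c ∈ component γ,
    ε.val γ α • bracket a (bracket b c) + ε.val β γ • bracket c (bracket a b)
      + ε.val α β • bracket b (bracket c a) = 0

namespace ColorLieAlgebra

variable {k : Type u} [Field k] {Γ : Type v} [AddCommGroup Γ] {ε : CommutationFactor k Γ}
  {g : Type w} [AddCommGroup g] [Module k g]

/-- A color Lie algebra is abelian if its bracket vanishes. -/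
def IsAbelian (L : ColorLieAlgebra ε g) : Prop :=
  ∀ x y : g, L.bracket x y = 0

/-- The defining relations `ab - ε(α, β) ba = ⟨a, b⟩` of the universal enveloping algebra,
for homogeneous elements `a` of degree `α` and `b` of degree `β`. -/
inductive EnvelopingRel (L : ColorLieAlgebra ε g) : TensorAlgebra k g → TensorAlgebra k g → Prop
  | of (α β : Γ) (a b : g) (ha : a ∈ L.component α) (hb : b ∈ L.component β) :
      EnvelopingRel L
        (TensorAlgebra.ι k a * TensorAlgebra.ι k b
          - ε.val α β • (TensorAlgebra.ι k b * TensorAlgebra.ι k a))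
        (TensorAlgebra.ι k (L.bracket a b))

/-- The universal enveloping algebra `U(g)`: the quotient of the tensor algebra of `g` by the
two-sided ideal generated by the relations `EnvelopingRel`. -/
abbrev Enveloping (L : ColorLieAlgebra ε g) : Type (max u w) :=
  RingQuot L.EnvelopingRel

/-- The augmentation `U(g) → k`, which sends every element of `g` to `0`. -/
def augmentation (L : ColorLieAlgebra ε g) : L.Enveloping →ₐ[k] k :=
  RingQuot.liftAlgHom k
    ⟨TensorAlgebra.lift k (0 : g →ₗ[k] k), by
      rintro _ _ ⟨α, β, a, b, ha, hb⟩
      simp⟩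

end ColorLieAlgebra

/-! ### `Tor` over a noncommutative algebra -/

/-- The subspace of `M ⊗_k N` spanned by the elements `(m a) ⊗ n - m ⊗ (a n)`. -/
def balancedRelations (k : Type u) [Field k] (A : Type v) [Ring A] [Algebra k A]
    (M : Type w) [AddCommGroup M] [Module k M] [Module Aᵐᵒᵖ M]
    (N : Type*) [AddCommGroup N] [Module k N] [Module A N] : Submodule k (M ⊗[k] N) :=
  Submodule.span k
    {t | ∃ (m : M) (a : A) (n : N), t = (MulOpposite.op a • m) ⊗ₜ[k] n - m ⊗ₜ[k] (a • n)}

/-- The tensor product `M ⊗_A N` of a right `A`-module `M` and a left `A`-module `N`, for an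
algebra `A` over the field `k`. -/
abbrev BalancedTensor (k : Type u) [Field k] (A : Type v) [Ring A] [Algebra k A]
    (M : Type w) [AddCommGroup M] [Module k M] [Module Aᵐᵒᵖ M]
    (N : Type*) [AddCommGroup N] [Module k N] [Module A N] :=
  (M ⊗[k] N) ⧸ balancedRelations k A M N

/-- The map `M ⊗_A N → M ⊗_A N'` induced by an `A`-linear map `N → N'`. -/
def BalancedTensor.map (k : Type u) [Field k] (A : Type v) [Ring A] [Algebra k A]
    (M : Type w) [AddCommGroup M] [Module k M] [Module Aᵐᵒᵖ M]
    {N N' : Type*} [AddCommGroup N] [Module k N] [Module A N] [IsScalarTower k A N]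
    [AddCommGroup N'] [Module k N'] [Module A N'] [IsScalarTower k A N']
    (f : N →ₗ[A] N') : BalancedTensor k A M N →ₗ[k] BalancedTensor k A M N' :=
  Submodule.mapQ _ _ ((f.restrictScalars k).lTensor M) <| by
    rw [balancedRelations, Submodule.span_le]
    rintro _ ⟨m, a, n, rfl⟩
    exact Submodule.subset_span ⟨m, a, f n, by simp⟩

/-- The functor `M ⊗_A -` from left `A`-modules to `k`-vector spaces, for a right `A`-module `M`
on which `k` acts through `A`. -/
def balancedTensorFunctor (k : Type u) [Field k] (A : Type u) [Ring A] [Algebra k A]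
    (M : Type u) [AddCommGroup M] [Module k M] [Module Aᵐᵒᵖ M] [IsScalarTower k Aᵐᵒᵖ M] :
    ModuleCat.{u} A ⥤ ModuleCat.{u} k where
  obj N := ModuleCat.of k (BalancedTensor k A M N)
  map f := ModuleCat.ofHom (BalancedTensor.map k A M f.hom)
  map_id N := by
    ext : 1
    refine Submodule.linearMap_qext _ (TensorProduct.ext' fun m n => ?_)
    simp [BalancedTensor.map]
  map_comp f h := by
    ext : 1
    refine Submodule.linearMap_qext _ (TensorProduct.ext' fun m n => ?_)
    simp [BalancedTensor.map]

instance (k : Type u) [Field k] (A : Type u) [Ring A] [Algebra k A]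
    (M : Type u) [AddCommGroup M] [Module k M] [Module Aᵐᵒᵖ M] [IsScalarTower k Aᵐᵒᵖ M] :
    (balancedTensorFunctor k A M).Additive where
  map_add {N N' f h} := by
    ext : 1
    rw [ModuleCat.hom_add]
    refine Submodule.linearMap_qext _ (TensorProduct.ext' fun m n => ?_)
    change Submodule.Quotient.mk (m ⊗ₜ[k] (f.hom n + h.hom n)) =
      (Submodule.Quotient.mk (m ⊗ₜ[k] f.hom n) + Submodule.Quotient.mk (m ⊗ₜ[k] h.hom n) :
        BalancedTensor k A M N')
    rw [TensorProduct.tmul_add, Submodule.Quotient.mk_add]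

/-- `Tor_i^A(M, N)`: the value at `N` of the `i`-th left derived functor of `M ⊗_A -`. -/
def algebraTor (k : Type u) [Field k] (A : Type u) [Ring A] [Algebra k A]
    (M : Type u) [AddCommGroup M] [Module k M] [Module Aᵐᵒᵖ M] [IsScalarTower k Aᵐᵒᵖ M]
    (i : ℕ) (N : ModuleCat.{u} A) : ModuleCat.{u} k :=
  ((balancedTensorFunctor k A M).leftDerived i).obj N

/-! ### Homology with trivial coefficients -/

/-- The ground field `k`, as a (left and right) module over an augmented algebra `A`,
via the augmentation. -/
def TrivialModule {k : Type u} [Field k] {A : Type v} [Ring A] [Algebra k A]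
    (_aug : A →ₐ[k] k) : Type u := k

namespace TrivialModule

variable {k : Type u} [Field k] {A : Type v} [Ring A] [Algebra k A] (aug : A →ₐ[k] k)

instance : AddCommGroup (TrivialModule aug) := inferInstanceAs (AddCommGroup k)

instance : Module k (TrivialModule aug) := inferInstanceAs (Module k k)

/-- `a • x = aug(a) x`. -/
instance : Module A (TrivialModule aug) := Module.compHom k aug.toRingHom

/-- `x • a = x aug(a)`. -/
instance : Module Aᵐᵒᵖ (TrivialModule aug) :=
  Module.compHom k (aug.toRingHom.fromOpposite fun _ _ => mul_comm _ _)

instance : IsScalarTower k Aᵐᵒᵖ (TrivialModule aug) where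
  smul_assoc c a x := by
    change aug (c • a.unop) * (show k from x) = c * (aug a.unop * (show k from x))
    rw [map_smul, smul_eq_mul, mul_assoc]

end TrivialModule

/-- `H_i(g) = Tor_i^{U(g)}(k, k)`, the homology of the color Lie algebra `g` with trivial
coefficients, as a vector space over `k`. -/
def ColorLieAlgebra.homology {k : Type u} [Field k] {Γ : Type v} [AddCommGroup Γ]
    {ε : CommutationFactor k Γ} {g : Type u} [AddCommGroup g] [Module k g]
    (L : ColorLieAlgebra ε g) (i : ℕ) : ModuleCat.{u} k :=
  algebraTor k L.Enveloping (TrivialModule L.augmentation) i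
    (ModuleCat.of L.Enveloping (TrivialModule L.augmentation))

/-- The Poincaré series `∑ z^i dim H_i(g)`. -/
def ColorLieAlgebra.poincareSeries {k : Type u} [Field k] {Γ : Type v} [AddCommGroup Γ]
    {ε : CommutationFactor k Γ} {g : Type u} [AddCommGroup g] [Module k g]
    (L : ColorLieAlgebra ε g) : PowerSeries ℚ :=
  PowerSeries.mk fun i => (Module.finrank k (L.homology i) : ℚ)

end

/-! For abelian `g` the algebra `U(g)` has generators `x i` and relations `x i * x j = E i j • (x j
* x i)`, where `E i j = ε(d_i, d_j)`. Since `E i j * E j i = 1`, each `E i i` is `1` or `-1`; in the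
second case `x i ^ 2 = 0`, because `2 ≠ 0`. Up to commutation scalars, `U(g)` is thus a tensor
product of `n - q` copies of `k[x]` and `q` copies of `k[x]/(x²)`.

Over `k[x]` the trivial module has a resolution with one generator in each of the degrees 0 and 1;
over `k[x]/(x²)` it has one with a single generator in every degree. Their twisted tensor product is
the Koszul complex: its generators are exponent vectors `c` with `c i ≤ 1` unless `E i i = -1`, and
the differential removes one unit from `c` while multiplying by the corresponding `x i`.

Four facts carry the argument. Ordered monomials form a basis of `U(g)` (`envelopingBasis`). The
Koszul complex is exact, by an explicit homotopy on the monomial basis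
(`koszulD_koszulHomotopy_add`). It is minimal (`koszulD_mem_span`), so its differential vanishes
after tensoring with `k`, and `H_m(g)` has a basis indexed by the exponent vectors of degree `m`.
Finally, the generating function of these vectors is a product over the variables, with factors `1 +
z` and `1/(1 - z)` (`mk_card_koszulIndex`). -/

noncomputable section

/-! ### Characters on exponent vectors -/

/-- The multiplicative character `c ↦ ∏ j, F j ^ c j` on exponent vectors. -/
def powProd {k : Type u} [Field k] {n : ℕ} (F : Fin n → k) (c : Fin n → ℕ) : k :=
  ∏ j, F j ^ c j

section PowProd

variable {k : Type u} [Field k] {n : ℕ}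

lemma powProd_add (F : Fin n → k) (a c : Fin n → ℕ) :
    powProd F (a + c) = powProd F a * powProd F c := by
  simp [powProd, pow_add, Finset.prod_mul_distrib]

lemma powProd_single (F : Fin n → k) (i : Fin n) : powProd F (Pi.single i 1) = F i := by
  rw [powProd, Finset.prod_eq_single i] <;> simp +contextual

lemma powProd_add_single (F : Fin n → k) (a : Fin n → ℕ) (i : Fin n) :
    powProd F (a + Pi.single i 1) = powProd F a * F i := by
  rw [powProd_add, powProd_single]

lemma powProd_ne_zero {F : Fin n → k} (hF : ∀ i, F i ≠ 0) (a : Fin n → ℕ) :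
    powProd F a ≠ 0 :=
  Finset.prod_ne_zero_iff.2 fun i _ => pow_ne_zero _ (hF i)

/-- Scalars picked up by moving `x i` from the right to its place in an ordered monomial. -/
def passRight (E : Fin n → Fin n → k) (i j : Fin n) : k := if i < j then E j i else 1

/-- Scalars with signs picked up by moving the derivation `∂ i` to its place. -/
def passLeft (E : Fin n → Fin n → k) (i j : Fin n) : k := if j < i then -E j i else 1

lemma passLeft_self (E : Fin n → Fin n → k) (i : Fin n) : passLeft E i i = 1 := by
  simp [passLeft]

lemma exists_eq_add_single {n : ℕ} {c : Fin n → ℕ} {i : Fin n} (hi : 0 < c i) :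
    ∃ c' : Fin n → ℕ, c = c' + Pi.single i 1 :=
  ⟨c - Pi.single i 1, (tsub_add_cancel_of_le fun j => by
    by_cases hj : j = i
    · subst hj
      simpa using Nat.one_le_of_lt hi
    · simp [hj]).symm⟩

lemma passRight_ne_zero {E : Fin n → Fin n → k} (hE : ∀ i j, E i j * E j i = 1) (i j : Fin n) :
    passRight E i j ≠ 0 := by
  unfold passRight
  split_ifs
  · exact left_ne_zero_of_mul_eq_one (hE j i)
  · exact one_ne_zero

lemma passLeft_ne_zero {E : Fin n → Fin n → k} (hE : ∀ i j, E i j * E j i = 1) (i j : Fin n) :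
    passLeft E i j ≠ 0 := by
  unfold passLeft
  split_ifs
  · exact neg_ne_zero.2 (left_ne_zero_of_mul_eq_one (hE j i))
  · exact one_ne_zero

/-- Whichever index is smaller, one product is `1` and the other is `-E i j * E j i = -1` up to
order. This is the source of all sign cancellations in the Koszul complex. -/
lemma passLeft_mul_passRight_add {E : Fin n → Fin n → k} (hE : ∀ i j, E i j * E j i = 1)
    {i j : Fin n} (hij : i ≠ j) :
    passLeft E j i * passRight E i j + passLeft E i j * passRight E j i = 0 := by
  rcases lt_or_gt_of_ne hij with h | h <;>
    simp [passLeft, passRight, h, h.not_gt, hE]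

lemma passRight_mul_comm {E : Fin n → Fin n → k} (hE : ∀ i j, E i j * E j i = 1)
    {i j : Fin n} (hij : i ≠ j) :
    passRight E j i = E i j * passRight E i j := by
  rcases lt_or_gt_of_ne hij with h | h <;>
    simp [passRight, h, h.not_gt, hE]

end PowProd

/-! ### Ordered monomials -/

/-- The ordered monomial `x 0 ^ a 0 * x 1 ^ a 1 * ⋯`. -/
def orderedMonomial {A : Type*} [Monoid A] {n : ℕ} (x : Fin n → A) (a : Fin n → ℕ) : A :=
  (List.ofFn fun i => x i ^ a i).prod

lemma orderedMonomial_succ {A : Type*} [Monoid A] {n : ℕ} (x : Fin (n + 1) → A)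
    (a : Fin (n + 1) → ℕ) :
    orderedMonomial x a =
      orderedMonomial (fun i => x i.castSucc) (fun i => a i.castSucc) *
        x (Fin.last n) ^ a (Fin.last n) := by
  rw [orderedMonomial, List.ofFn_succ', List.concat_eq_append, List.prod_append, List.prod_singleton]; rfl

lemma orderedMonomial_zero {A : Type*} [Monoid A] {n : ℕ} (x : Fin n → A) :
    orderedMonomial x 0 = 1 := by
  simp [orderedMonomial]

lemma pow_mul_of_mul_eq_smul {k A : Type*} [Field k] [Ring A] [Algebra k A] {x y : A} {e : k}
    (h : y * x = e • (x * y)) (m : ℕ) : y ^ m * x = e ^ m • (x * y ^ m) := by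
  induction m with
  | zero => simp
  | succ m ih =>
    rw [pow_succ, mul_assoc, h, mul_smul_comm, ← mul_assoc, ih, smul_mul_assoc, smul_smul,
      mul_assoc, ← pow_succ']

/-- The factor `x i` travels left past every `x j` with `j > i`, each swap costing `E j i`. The
induction splits off the last variable. -/
lemma orderedMonomial_mul {k : Type u} {A : Type*} [Field k] [Ring A] [Algebra k A] {n : ℕ}
    (E : Fin n → Fin n → k) (x : Fin n → A) (hx : ∀ i j, x i * x j = E i j • (x j * x i))
    (a : Fin n → ℕ) (i : Fin n) :
    orderedMonomial x a * x i =
      powProd (passRight E i) a • orderedMonomial x (a + Pi.single i 1) := by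
  induction n with
  | zero => exact i.elim0
  | succ n ih =>
    rw [orderedMonomial_succ, orderedMonomial_succ x (a + _)]
    refine Fin.lastCases ?_ (fun i => ?_) i
    · have h1 : powProd (passRight E (Fin.last n)) a = 1 := by
        simp [powProd, passRight, (Fin.le_last _).not_gt]
      have h2 : (fun j : Fin n => (a + Pi.single (Fin.last n) 1 : Fin (n + 1) → ℕ) j.castSucc)
          = fun j => a j.castSucc := by
        ext j
        simp
      rw [h1, h2, one_smul, mul_assoc, ← pow_succ]
      simp
    · have h1 : powProd (passRight E i.castSucc) a =
          powProd (passRight (fun i j => E i.castSucc j.castSucc) i) (fun j => a j.castSucc) *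
            E (Fin.last n) i.castSucc ^ a (Fin.last n) := by
        simp [powProd, passRight, Fin.prod_univ_castSucc, Fin.castSucc_lt_last]
      have h2 : (fun j : Fin n => (a + Pi.single i.castSucc 1 : Fin (n + 1) → ℕ) j.castSucc)
          = (fun j => a j.castSucc) + Pi.single i 1 := by
        ext j
        simp [Pi.single_apply]
      have h3 : (a + Pi.single i.castSucc 1 : Fin (n + 1) → ℕ) (Fin.last n) = a (Fin.last n) := by
        simp
      rw [h1, h2, h3, mul_assoc, pow_mul_of_mul_eq_smul (hx (Fin.last n) i.castSucc),
        mul_smul_comm, ← mul_assoc,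
        ih (fun i j => E i.castSucc j.castSucc) _ (fun _ _ => hx _ _), smul_mul_assoc, smul_smul,
        mul_comm]

lemma orderedMonomial_eq_zero {A : Type*} [Ring A] {n : ℕ} (x : Fin n → A) (a : Fin n → ℕ)
    (i : Fin n) (hi : x i ^ a i = 0) : orderedMonomial x a = 0 :=
  List.prod_eq_zero (List.mem_ofFn.2 ⟨i, hi⟩)

/-! ### Skew polynomial algebras -/

/-- The exponents of the ordered monomials that form a basis of the skew polynomial algebra with
relations `x i * x j = E i j • (x j * x i)`. -/
def IsMonomialExponent {k : Type u} [Field k] {n : ℕ} (E : Fin n → Fin n → k)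
    (a : Fin n → ℕ) : Prop :=
  ∀ i, E i i = -1 → a i ≤ 1

section SkewPolynomial

variable {k : Type u} [Field k] {n : ℕ} {E : Fin n → Fin n → k}

lemma IsMonomialExponent.zero : IsMonomialExponent E 0 := fun _ _ => zero_le_one

lemma IsMonomialExponent.of_add {a c : Fin n → ℕ} (h : IsMonomialExponent E (a + c)) :
    IsMonomialExponent E a :=
  fun i hi => le_trans (Nat.le_add_right _ _) (h i hi)

open Classical in
/-- A family indexed by the monomial exponents, extended by zero to all exponent vectors. -/
def extendExponent {M : Type*} [Zero M] (f : {a : Fin n → ℕ // IsMonomialExponent E a} → M)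
    (a : Fin n → ℕ) : M :=
  if h : IsMonomialExponent E a then f ⟨a, h⟩ else 0

lemma extendExponent_of {M : Type*} [Zero M]
    (f : {a : Fin n → ℕ // IsMonomialExponent E a} → M) {a : Fin n → ℕ}
    (h : IsMonomialExponent E a) : extendExponent f a = f ⟨a, h⟩ :=
  dif_pos h

lemma extendExponent_of_not {M : Type*} [Zero M]
    (f : {a : Fin n → ℕ // IsMonomialExponent E a} → M) {a : Fin n → ℕ}
    (h : ¬ IsMonomialExponent E a) : extendExponent f a = 0 :=
  dif_neg h

variable (E) in
/-- The formal monomial with exponent vector `a`. -/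
def formalMonomial (a : Fin n → ℕ) : {a : Fin n → ℕ // IsMonomialExponent E a} →₀ k :=
  extendExponent (fun a => Finsupp.single a 1) a

variable (E) in
/-- Right multiplication by `x i` on formal monomials. -/
def formalMulRight (i : Fin n) :
    ({a : Fin n → ℕ // IsMonomialExponent E a} →₀ k) →ₗ[k]
      ({a : Fin n → ℕ // IsMonomialExponent E a} →₀ k) :=
  Finsupp.linearCombination k fun a =>
    powProd (passRight E i) a.1 • formalMonomial E (a.1 + Pi.single i 1)

/-- Valid for all exponent vectors: if `a` is inadmissible, so is `a + Pi.single i 1`, and both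
sides are zero. -/
lemma formalMulRight_formalMonomial (i : Fin n) (a : Fin n → ℕ) :
    formalMulRight E i (formalMonomial E a) =
      powProd (passRight E i) a • formalMonomial E (a + Pi.single i 1) := by
  by_cases h : IsMonomialExponent E a
  · simp [formalMonomial, extendExponent_of _ h, formalMulRight]
  · rw [formalMonomial, formalMonomial, extendExponent_of_not _ h,
      extendExponent_of_not _ (fun h' => h h'.of_add), map_zero, smul_zero]

lemma formalMonomial_ext {M : Type*} [AddCommGroup M] [Module k M]
    {f f' : ({a : Fin n → ℕ // IsMonomialExponent E a} →₀ k) →ₗ[k] M}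
    (h : ∀ a, f (formalMonomial E a) = f' (formalMonomial E a)) : f = f' := by
  refine Finsupp.lhom_ext' fun a => LinearMap.ext_ring ?_
  have := h a.1
  rwa [formalMonomial, extendExponent_of _ a.2] at this

lemma eq_one_or_eq_neg_one_of_mul_swap (hE : ∀ i j, E i j * E j i = 1) (i : Fin n) :
    E i i = 1 ∨ E i i = -1 :=
  mul_self_eq_one_iff.1 (hE i i)

lemma not_isMonomialExponent_add {i : Fin n} (hi : E i i = -1) (a : Fin n → ℕ) :
    ¬ IsMonomialExponent E (a + Pi.single i 1 + Pi.single i 1) := fun h => by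
  have := h i hi
  simp at this

/-- These are the defining relations of `U(g)` for basis vectors. When `i = j` and `E i i = -1`,
both sides vanish because an exponent of at least 2 is inadmissible. -/
lemma formalMulRight_comm (hE : ∀ i j, E i j * E j i = 1) (i j : Fin n)
    (v : {a : Fin n → ℕ // IsMonomialExponent E a} →₀ k) :
    formalMulRight E j (formalMulRight E i v) =
      E i j • formalMulRight E i (formalMulRight E j v) := by
  suffices formalMulRight E j ∘ₗ formalMulRight E i =
      E i j • (formalMulRight E i ∘ₗ formalMulRight E j) from LinearMap.congr_fun this v
  refine formalMonomial_ext fun a => ?_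
  simp only [LinearMap.comp_apply, LinearMap.smul_apply, formalMulRight_formalMonomial, map_smul,
    powProd_add_single, smul_smul]
  by_cases hij : i = j
  · subst hij
    rcases eq_one_or_eq_neg_one_of_mul_swap hE i with h | h
    · rw [h, one_mul]
    · rw [formalMonomial, extendExponent_of_not _ (not_isMonomialExponent_add h a), smul_zero,
        smul_zero]
  · rw [passRight_mul_comm hE hij, add_right_comm]
    congr 1
    ring

/-- An algebra with generators `x i` satisfying `x i * x j = E i j • (x j * x i)`, whose ordered
monomials form a basis. -/
structure SkewPolynomialBasis (E : Fin n → Fin n → k) (A : Type*) [Ring A] [Algebra k A] where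
  x : Fin n → A
  basis : Module.Basis {a : Fin n → ℕ // IsMonomialExponent E a} k A
  extend_zero : extendExponent basis 0 = 1
  extend_mul_x : ∀ a i, extendExponent basis a * x i =
    powProd (passRight E i) a • extendExponent basis (a + Pi.single i 1)

end SkewPolynomial

/-! ### The enveloping algebra of an abelian color Lie algebra -/

namespace ColorLieAlgebra

variable {k : Type u} [Field k] {Γ : Type v} [AddCommGroup Γ] {ε : CommutationFactor k Γ}
  {g : Type w} [AddCommGroup g] [Module k g] (L : ColorLieAlgebra ε g) {n : ℕ}

/-- The part of `x` outside degree `α` lies both in the component of `α` and in the sum of the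
others, so independence kills it. This reduces relations between arbitrary homogeneous elements to
relations between basis vectors. -/
lemma repr_eq_zero_of_mem (b : Module.Basis (Fin n) k g) {deg : Fin n → Γ}
    (hb : ∀ i, b i ∈ L.component (deg i)) {α : Γ} {x : g} (hx : x ∈ L.component α) {i : Fin n}
    (hi : deg i ≠ α) : b.repr x i = 0 := by
  classical
  have hind := L.isInternal.submodule_iSupIndep α
  set y : g := ∑ j, if deg j = α then b.repr x j • b j else 0 with hy
  set z : g := ∑ j, if deg j = α then 0 else b.repr x j • b j with hz
  have hxyz : x = y + z := by
    rw [hy, hz, ← Finset.sum_add_distrib]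
    conv_lhs => rw [← b.sum_repr x]
    exact Finset.sum_congr rfl fun j _ => by split_ifs <;> simp
  have hyα : y ∈ L.component α := Submodule.sum_mem _ fun j _ => by
    split_ifs with h
    · exact Submodule.smul_mem _ _ (h ▸ hb j)
    · exact Submodule.zero_mem _
  have hzα : z ∈ L.component α := by
    rw [show z = x - y by rw [hxyz, add_sub_cancel_left]]
    exact Submodule.sub_mem _ hx hyα
  have hz' : z ∈ ⨆ β, ⨆ (_ : β ≠ α), L.component β := Submodule.sum_mem _ fun j _ => by
    split_ifs with h
    · exact Submodule.zero_mem _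
    · exact Submodule.smul_mem _ _
        (Submodule.mem_iSup_of_mem (deg j) (Submodule.mem_iSup_of_mem h (hb j)))
  have hz0 : z = 0 := (Submodule.disjoint_def.1 hind) z hzα hz'
  have h1 : b.repr z i = b.repr x i := by
    rw [hz, map_sum, Finsupp.finsetSum_apply, Finset.sum_eq_single i]
    · simp [hi]
    · intro j _ hj
      split_ifs <;> simp [hj]
    · simp
  rw [← h1, hz0, map_zero, Finsupp.zero_apply]

lemma commutationMatrix_mul_swap (ε : CommutationFactor k Γ) (deg : Fin n → Γ) (i j : Fin n) :
    ε.val (deg i) (deg j) * ε.val (deg j) (deg i) = 1 := by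
  simp only [CommutationFactor.val, ← Units.val_mul, ε.mul_swap, Units.val_one]

/-- The generator of the enveloping algebra attached to a vector. -/
def toEnveloping : g →ₗ[k] L.Enveloping :=
  (RingQuot.mkAlgHom k L.EnvelopingRel).toLinearMap ∘ₗ TensorAlgebra.ι k

lemma augmentation_toEnveloping (a : g) : L.augmentation (L.toEnveloping a) = 0 := by
  simp [toEnveloping, augmentation]

variable {L}

lemma toEnveloping_mul (hL : L.IsAbelian) {α β : Γ} {a c : g} (ha : a ∈ L.component α)
    (hc : c ∈ L.component β) :
    L.toEnveloping a * L.toEnveloping c =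
      ε.val α β • (L.toEnveloping c * L.toEnveloping a) := by
  have := RingQuot.mkAlgHom_rel k (EnvelopingRel.of (L := L) α β a c ha hc)
  rw [hL, map_zero, map_zero, map_sub, map_mul, map_smul, map_mul, sub_eq_zero] at this
  exact this

lemma toEnveloping_induction {C : L.Enveloping → Prop}
    (algebraMap : ∀ r : k, C (algebraMap k _ r)) (ι : ∀ a, C (L.toEnveloping a))
    (mul : ∀ a c, C a → C c → C (a * c)) (add : ∀ a c, C a → C c → C (a + c))
    (u : L.Enveloping) : C u := by
  obtain ⟨t, rfl⟩ := RingQuot.mkAlgHom_surjective k L.EnvelopingRel u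
  induction t using TensorAlgebra.induction with
  | algebraMap r => simpa using algebraMap r
  | ι a => exact ι a
  | mul a c ha hc => rw [map_mul]; exact mul _ _ ha hc
  | add a c ha hc => rw [map_add]; exact add _ _ ha hc

/-- The commutation factors of the degrees of a basis. -/
abbrev commutationMatrix (ε : CommutationFactor k Γ) (deg : Fin n → Γ) (i j : Fin n) : k :=
  ε.val (deg i) (deg j)

/-- The right action of the enveloping algebra on formal monomials. -/
def formalAction (hL : L.IsAbelian) (b : Module.Basis (Fin n) k g) (deg : Fin n → Γ)
    (hb : ∀ i, b i ∈ L.component (deg i)) :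
    L.Enveloping →ₐ[k] (Module.End k
      ({a : Fin n → ℕ // IsMonomialExponent (commutationMatrix ε deg) a} →₀ k))ᵐᵒᵖ :=
  RingQuot.liftAlgHom k ⟨TensorAlgebra.lift k (b.constr k fun i =>
    MulOpposite.op (formalMulRight (commutationMatrix ε deg) i)), by
      rintro _ _ ⟨α, β, a, c, ha, hc⟩
      rw [hL, map_zero, map_zero, map_sub, map_mul, map_smul, map_mul, TensorAlgebra.lift_ι_apply,
        TensorAlgebra.lift_ι_apply, sub_eq_zero, b.constr_apply_fintype k, b.constr_apply_fintype k,
        Finset.sum_mul_sum, Finset.sum_mul_sum, Finset.sum_comm, Finset.smul_sum]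
      refine Finset.sum_congr rfl fun j _ => ?_
      rw [Finset.smul_sum]
      refine Finset.sum_congr rfl fun i _ => ?_
      simp only [b.equivFun_apply, smul_mul_smul_comm]
      -- A coordinate at a basis vector of the wrong degree is zero; for the remaining pairs `ε(α,
      -- β)` is the matrix entry `E i j`.
      by_cases hi : deg i = α
      · by_cases hj : deg j = β
        · have h : MulOpposite.op (formalMulRight (commutationMatrix ε deg) i) *
              MulOpposite.op (formalMulRight (commutationMatrix ε deg) j) =
              ε.val α β • (MulOpposite.op (formalMulRight (commutationMatrix ε deg) j) *
              MulOpposite.op (formalMulRight (commutationMatrix ε deg) i)) := by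
            rw [← MulOpposite.op_mul, ← MulOpposite.op_mul, ← MulOpposite.op_smul, ← hi, ← hj]
            congr 1
            exact LinearMap.ext fun v =>
              formalMulRight_comm (commutationMatrix_mul_swap ε deg) i j v
          rw [h, smul_comm, mul_comm]
        · simp [L.repr_eq_zero_of_mem b hb hc hj]
      · simp [L.repr_eq_zero_of_mem b hb ha hi]⟩

lemma formalAction_toEnveloping (hL : L.IsAbelian) (b : Module.Basis (Fin n) k g)
    (deg : Fin n → Γ) (hb : ∀ i, b i ∈ L.component (deg i)) (i : Fin n) :
    formalAction hL b deg hb (L.toEnveloping (b i)) =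
      MulOpposite.op (formalMulRight (commutationMatrix ε deg) i) := by
  simp [formalAction, toEnveloping]

/-- The action of an element on the formal monomial `1`. -/
def formalSymbol (hL : L.IsAbelian) (b : Module.Basis (Fin n) k g) (deg : Fin n → Γ)
    (hb : ∀ i, b i ∈ L.component (deg i)) :
    L.Enveloping →ₗ[k]
      ({a : Fin n → ℕ // IsMonomialExponent (commutationMatrix ε deg) a} →₀ k) :=
  LinearMap.applyₗ (formalMonomial _ 0) ∘ₗ (MulOpposite.opLinearEquiv k).symm.toLinearMap ∘ₗ
    (formalAction hL b deg hb).toLinearMap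

lemma formalSymbol_apply (hL : L.IsAbelian) (b : Module.Basis (Fin n) k g) (deg : Fin n → Γ)
    (hb : ∀ i, b i ∈ L.component (deg i)) (u : L.Enveloping) :
    formalSymbol hL b deg hb u =
      (formalAction hL b deg hb u).unop (formalMonomial _ 0) := rfl

lemma formalSymbol_mul (hL : L.IsAbelian) (b : Module.Basis (Fin n) k g) (deg : Fin n → Γ)
    (hb : ∀ i, b i ∈ L.component (deg i)) (u : L.Enveloping) (i : Fin n) :
    formalSymbol hL b deg hb (u * L.toEnveloping (b i)) =
      formalMulRight (commutationMatrix ε deg) i (formalSymbol hL b deg hb u) := by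
  rw [formalSymbol_apply, map_mul, formalAction_toEnveloping]
  rfl

lemma formalSymbol_one (hL : L.IsAbelian) (b : Module.Basis (Fin n) k g) (deg : Fin n → Γ)
    (hb : ∀ i, b i ∈ L.component (deg i)) :
    formalSymbol hL b deg hb 1 = formalMonomial _ 0 := by
  rw [formalSymbol_apply, map_one]
  rfl

/-- Evaluation of formal monomials as ordered monomials in the enveloping algebra. -/
def evalMonomial (L : ColorLieAlgebra ε g) (b : Module.Basis (Fin n) k g) (deg : Fin n → Γ) :
    ({a : Fin n → ℕ // IsMonomialExponent (commutationMatrix ε deg) a} →₀ k) →ₗ[k]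
      L.Enveloping :=
  Finsupp.linearCombination k fun a => orderedMonomial (fun i => L.toEnveloping (b i)) a.1

lemma _root_.eq_zero_of_eq_neg_one_smul {M : Type*} [AddCommGroup M] [Module k M]
    (hk2 : (2 : k) ≠ 0) {x : M} (h : x = (-1 : k) • x) : x = 0 := by
  rw [neg_one_smul, eq_neg_iff_add_eq_zero, ← two_smul k] at h
  exact (smul_eq_zero.1 h).resolve_left hk2

lemma toEnveloping_sq (hk2 : (2 : k) ≠ 0) (hL : L.IsAbelian) {α : Γ} {a : g}
    (ha : a ∈ L.component α) (hα : ε.val α α = -1) :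
    L.toEnveloping a * L.toEnveloping a = 0 := by
  have h := toEnveloping_mul hL ha ha
  rw [hα] at h
  exact eq_zero_of_eq_neg_one_smul hk2 h

lemma evalMonomial_formalMonomial (hk2 : (2 : k) ≠ 0) (hL : L.IsAbelian)
    (b : Module.Basis (Fin n) k g) (deg : Fin n → Γ) (hb : ∀ i, b i ∈ L.component (deg i))
    (a : Fin n → ℕ) :
    evalMonomial L b deg (formalMonomial _ a) =
      orderedMonomial (fun i => L.toEnveloping (b i)) a := by
  by_cases h : IsMonomialExponent (commutationMatrix ε deg) a
  · rw [formalMonomial, extendExponent_of _ h]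
    simp [evalMonomial]
  · rw [formalMonomial, extendExponent_of_not _ h, map_zero]
    simp only [IsMonomialExponent, not_forall, not_le] at h
    obtain ⟨i, hi, hai⟩ := h
    refine (orderedMonomial_eq_zero _ _ i ?_).symm
    obtain ⟨m, hm⟩ := Nat.exists_eq_add_of_lt hai
    rw [hm, add_right_comm, pow_add, pow_succ, pow_one, toEnveloping_sq hk2 hL (hb i) hi, zero_mul]

/-- Evaluation intertwines the formal action with right multiplication. Applied to the formal
monomial `1`, this makes evaluation a left inverse of the symbol: the spanning half of the basis
theorem. -/
lemma evalMonomial_formalAction (hk2 : (2 : k) ≠ 0) (hL : L.IsAbelian)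
    (b : Module.Basis (Fin n) k g) (deg : Fin n → Γ) (hb : ∀ i, b i ∈ L.component (deg i))
    (u : L.Enveloping) : ∀ v, evalMonomial L b deg ((formalAction hL b deg hb u).unop v) =
      evalMonomial L b deg v * u := by
  induction u using toEnveloping_induction with
  | algebraMap r =>
    intro v
    rw [AlgHom.commutes, MulOpposite.algebraMap_apply, MulOpposite.unop_op,
      Module.algebraMap_end_apply, map_smul, Algebra.smul_def, Algebra.commutes]
  | ι a =>
    intro v
    rw [← b.sum_repr a]
    simp only [map_sum, map_smul, formalAction_toEnveloping, Finset.mul_sum, mul_smul_comm,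
      Finset.unop_sum, MulOpposite.unop_smul, MulOpposite.unop_op, LinearMap.sum_apply,
      LinearMap.smul_apply]
    refine Finset.sum_congr rfl fun i _ => ?_
    congr 1
    suffices evalMonomial L b deg ∘ₗ formalMulRight _ i =
        LinearMap.mulRight k (L.toEnveloping (b i)) ∘ₗ evalMonomial L b deg from
      LinearMap.congr_fun this v
    refine formalMonomial_ext fun a => ?_
    simp only [LinearMap.comp_apply, LinearMap.mulRight_apply, formalMulRight_formalMonomial,
      map_smul, evalMonomial_formalMonomial hk2 hL b deg hb]
    exact (orderedMonomial_mul _ _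
      (fun i j => toEnveloping_mul hL (hb i) (hb j)) a i).symm
  | mul a c ha hc =>
    intro v
    rw [map_mul, MulOpposite.unop_mul, Module.End.mul_apply, hc, ha, mul_assoc]
  | add a c ha hc =>
    intro v
    rw [map_add, MulOpposite.unop_add, LinearMap.add_apply, map_add, ha, hc, mul_add]

lemma evalMonomial_formalSymbol (hk2 : (2 : k) ≠ 0) (hL : L.IsAbelian)
    (b : Module.Basis (Fin n) k g) (deg : Fin n → Γ) (hb : ∀ i, b i ∈ L.component (deg i))
    (u : L.Enveloping) :
    evalMonomial L b deg (formalSymbol hL b deg hb u) = u := by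
  rw [formalSymbol_apply, evalMonomial_formalAction hk2,
    evalMonomial_formalMonomial hk2 hL b deg hb, orderedMonomial_zero, one_mul]

/-- The independence half of the basis theorem: a nontrivial formal monomial is, up to an invertible
scalar, a shorter one acted on by a generator. -/
lemma formalMonomial_mem_range_formalSymbol (hL : L.IsAbelian)
    (b : Module.Basis (Fin n) k g) (deg : Fin n → Γ) (hb : ∀ i, b i ∈ L.component (deg i))
    (m : ℕ) : ∀ a : Fin n → ℕ, ∑ i, a i = m →
      formalMonomial _ a ∈ LinearMap.range (formalSymbol hL b deg hb) := by
  induction m with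
  | zero =>
    intro a ha
    obtain rfl : a = 0 := funext fun i => Finset.sum_eq_zero_iff.1 ha i (Finset.mem_univ i)
    exact ⟨1, formalSymbol_one hL b deg hb⟩
  | succ m ih =>
    intro a ha
    obtain ⟨i, -, hi⟩ := Finset.exists_ne_zero_of_sum_ne_zero (ha.trans_ne m.succ_ne_zero)
    obtain ⟨a, rfl⟩ := exists_eq_add_single (Nat.pos_of_ne_zero hi)
    obtain ⟨u, hu⟩ := ih a (by simpa [Finset.sum_add_distrib] using ha)
    refine ⟨(powProd (passRight (commutationMatrix ε deg) i) a)⁻¹ • (u * L.toEnveloping (b i)), ?_⟩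
    rw [map_smul, formalSymbol_mul, hu, formalMulRight_formalMonomial, inv_smul_smul₀]
    exact powProd_ne_zero (passRight_ne_zero (commutationMatrix_mul_swap ε deg) i) a

/-- The Poincaré–Birkhoff–Witt basis of the enveloping algebra of an abelian color Lie algebra. -/
def envelopingBasis (hk2 : (2 : k) ≠ 0) (hL : L.IsAbelian)
    (b : Module.Basis (Fin n) k g) (deg : Fin n → Γ) (hb : ∀ i, b i ∈ L.component (deg i)) :
    Module.Basis {a : Fin n → ℕ // IsMonomialExponent (commutationMatrix ε deg) a} k
      L.Enveloping :=
  .ofRepr <| LinearEquiv.ofBijective (formalSymbol hL b deg hb)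
    ⟨Function.LeftInverse.injective (evalMonomial_formalSymbol hk2 hL b deg hb), by
      rw [← LinearMap.range_eq_top, ← top_le_iff, ← (Finsupp.basisSingleOne).span_eq,
        Submodule.span_le]
      rintro _ ⟨a, rfl⟩
      have := formalMonomial_mem_range_formalSymbol hL b deg hb _ a.1 rfl
      rw [formalMonomial, extendExponent_of _ a.2] at this
      rwa [Finsupp.coe_basisSingleOne]⟩

lemma formalSymbol_extendExponent (hk2 : (2 : k) ≠ 0) (hL : L.IsAbelian)
    (b : Module.Basis (Fin n) k g) (deg : Fin n → Γ) (hb : ∀ i, b i ∈ L.component (deg i))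
    (a : Fin n → ℕ) :
    formalSymbol hL b deg hb (extendExponent (envelopingBasis hk2 hL b deg hb) a) =
      formalMonomial _ a := by
  by_cases h : IsMonomialExponent (commutationMatrix ε deg) a
  · rw [extendExponent_of _ h, formalMonomial, extendExponent_of _ h]
    exact (envelopingBasis hk2 hL b deg hb).repr_self _
  · rw [extendExponent_of_not _ h, formalMonomial, extendExponent_of_not _ h, map_zero]

/-- The enveloping algebra of an abelian color Lie algebra is a skew polynomial algebra. -/
def skewPolynomialBasis (hk2 : (2 : k) ≠ 0) (hL : L.IsAbelian)
    (b : Module.Basis (Fin n) k g) (deg : Fin n → Γ) (hb : ∀ i, b i ∈ L.component (deg i)) :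
    SkewPolynomialBasis (commutationMatrix ε deg) L.Enveloping where
  x i := L.toEnveloping (b i)
  basis := envelopingBasis hk2 hL b deg hb
  extend_zero := Function.LeftInverse.injective (evalMonomial_formalSymbol hk2 hL b deg hb) <| by
    rw [formalSymbol_extendExponent, formalSymbol_one]
  extend_mul_x a i :=
    Function.LeftInverse.injective (evalMonomial_formalSymbol hk2 hL b deg hb) <| by
      rw [formalSymbol_mul, map_smul, formalSymbol_extendExponent, formalSymbol_extendExponent,
        formalMulRight_formalMonomial]

end ColorLieAlgebra

/-! ### The Koszul complex of a skew polynomial algebra -/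

/-- The exponents, of total degree `m`, of the divided power and exterior monomials that generate
the Koszul complex. -/
def IsKoszulExponent {k : Type u} [Field k] {n : ℕ} (E : Fin n → Fin n → k) (m : ℕ)
    (c : Fin n → ℕ) : Prop :=
  (∀ i, E i i ≠ -1 → c i ≤ 1) ∧ ∑ i, c i = m

/-- The generators of the Koszul complex in degree `m`. -/
abbrev KoszulIndex {k : Type u} [Field k] {n : ℕ} (E : Fin n → Fin n → k) (m : ℕ) : Type :=
  {c : Fin n → ℕ // IsKoszulExponent E m c}

namespace SkewPolynomialBasis

variable {k : Type u} [Field k] {n : ℕ} {E : Fin n → Fin n → k} {A : Type u} [Ring A]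

section Exponents

lemma isKoszulExponent_succ_add_single {m : ℕ} {c : Fin n → ℕ} {i : Fin n}
    (hc : IsKoszulExponent E m c) (hi : E i i ≠ -1 → c i = 0) :
    IsKoszulExponent E (m + 1) (c + Pi.single i 1) := by
  refine ⟨fun j hj => ?_, by simp [Finset.sum_add_distrib, hc.2]⟩
  by_cases hij : j = i
  · subst hij
    simp [hi hj]
  · simpa [hij] using hc.1 j hj

lemma isKoszulExponent_of_add_single {m : ℕ} {c : Fin n → ℕ} {i : Fin n}
    (hc : IsKoszulExponent E (m + 1) (c + Pi.single i 1)) : IsKoszulExponent E m c :=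
  ⟨fun j hj => le_trans (Nat.le_add_right _ _) (hc.1 j hj), by
    simpa [Finset.sum_add_distrib] using hc.2⟩

lemma isMonomialExponent_add_single {a : Fin n → ℕ} {i : Fin n}
    (ha : IsMonomialExponent E a) (hi : E i i = -1 → a i = 0) :
    IsMonomialExponent E (a + Pi.single i 1) := by
  intro j hj
  by_cases hij : j = i
  · subst hij
    simp [hi hj]
  · simpa [hij] using ha j hj

variable (E) in
/-- The coefficient of `∂ i` on the monomial with exponents `a` and `c`. -/
def koszulCoeff (i : Fin n) (a c : Fin n → ℕ) : k :=
  powProd (passRight E i) a * powProd (passLeft E i) c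

lemma koszulCoeff_ne_zero (hE : ∀ i j, E i j * E j i = 1) (i : Fin n) (a c : Fin n → ℕ) :
    koszulCoeff E i a c ≠ 0 :=
  mul_ne_zero (powProd_ne_zero (passRight_ne_zero hE i) a)
    (powProd_ne_zero (passLeft_ne_zero hE i) c)

/-- Moving one unit of `i` and one of `j` from `c` to `a` in the two possible orders gives opposite
scalars. This serves both for `d² = 0` and for the cross terms of the homotopy. -/
lemma koszulCoeff_mul_add (hE : ∀ i j, E i j * E j i = 1) {i j : Fin n} (hij : i ≠ j)
    (a c : Fin n → ℕ) :
    koszulCoeff E j a (c + Pi.single j 1 + Pi.single i 1) *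
        koszulCoeff E i (a + Pi.single j 1) (c + Pi.single i 1) =
      -(koszulCoeff E i a (c + Pi.single j 1 + Pi.single i 1) *
        koszulCoeff E j (a + Pi.single i 1) (c + Pi.single j 1)) := by
  simp only [koszulCoeff, powProd_add_single, passLeft_self]
  linear_combination powProd (passRight E i) a * powProd (passRight E j) a *
    powProd (passLeft E i) c * powProd (passLeft E j) c * passLeft_mul_passRight_add hE hij

end Exponents

open Classical in
variable (E A) in
/-- The inclusion of the summand with index `c`; it is zero if `c` is not an index. -/
def koszulSingle (m : ℕ) (c : Fin n → ℕ) : A →ₗ[A] (KoszulIndex E m →₀ A) :=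
  if h : IsKoszulExponent E m c then Finsupp.lsingle ⟨c, h⟩ else 0

lemma koszulSingle_of {m : ℕ} {c : Fin n → ℕ} (h : IsKoszulExponent E m c) (u : A) :
    koszulSingle E A m c u = Finsupp.single ⟨c, h⟩ u := by
  simp [koszulSingle, h]

lemma koszulSingle_of_not {m : ℕ} {c : Fin n → ℕ} (h : ¬ IsKoszulExponent E m c) :
    koszulSingle E A m c = 0 := by
  simp [koszulSingle, h]

variable [Algebra k A]

lemma koszulSingle_smul (m : ℕ) (c : Fin n → ℕ) (r : k) (u : A) :
    koszulSingle E A m c (r • u) = r • koszulSingle E A m c u :=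
  LinearMap.map_smul_of_tower _ r u

variable (B : SkewPolynomialBasis E A)

/-- The differential of the Koszul complex. -/
def koszulD (m m' : ℕ) : (KoszulIndex E m →₀ A) →ₗ[A] (KoszulIndex E m' →₀ A) :=
  Finsupp.linearCombination A fun c => ∑ i, if 0 < c.1 i then
    koszulSingle E A m' (c.1 - Pi.single i 1) (powProd (passLeft E i) c.1 • B.x i) else 0

/-- The monomials that form a basis of the Koszul complex over the ground field. -/
def koszulMonomial (m : ℕ) (a c : Fin n → ℕ) : KoszulIndex E m →₀ A :=
  koszulSingle E A m c (extendExponent B.basis a)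

lemma koszulMonomial_of_not_left {m : ℕ} {a c : Fin n → ℕ} (h : ¬ IsMonomialExponent E a) :
    B.koszulMonomial m a c = 0 := by
  rw [koszulMonomial, extendExponent_of_not _ h, map_zero]

lemma koszulMonomial_of_not_right {m : ℕ} {a c : Fin n → ℕ} (h : ¬ IsKoszulExponent E m c) :
    B.koszulMonomial m a c = 0 := by
  rw [koszulMonomial, koszulSingle_of_not h, LinearMap.zero_apply]

/-- The multidegree `a + c` is preserved. No factor `c i` occurs, as for divided powers, so later
divisions are only by products of signs and commutation factors. -/
lemma koszulD_koszulMonomial {m : ℕ} (m' : ℕ) (a : Fin n → ℕ) {c : Fin n → ℕ}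
    (hc : IsKoszulExponent E m c) :
    B.koszulD m m' (B.koszulMonomial m a c) = ∑ i, if 0 < c i then koszulCoeff E i a c •
      B.koszulMonomial m' (a + Pi.single i 1) (c - Pi.single i 1) else 0 := by
  rw [koszulMonomial, koszulSingle_of hc, koszulD, Finsupp.linearCombination_single,
    Finset.smul_sum]
  refine Finset.sum_congr rfl fun i _ => ?_
  split_ifs
  · rw [← map_smul, smul_eq_mul, mul_smul_comm, B.extend_mul_x, smul_smul, koszulSingle_smul,
      koszulCoeff, mul_comm, koszulMonomial]
  · rw [smul_zero]

/-- The monomial basis of the Koszul complex over the ground field. -/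
def koszulBasis (m : ℕ) : Module.Basis
    (Σ _ : KoszulIndex E m, {a : Fin n → ℕ // IsMonomialExponent E a}) k
    (KoszulIndex E m →₀ A) :=
  Finsupp.basis fun _ => B.basis

lemma koszulBasis_apply (m : ℕ)
    (p : Σ _ : KoszulIndex E m, {a : Fin n → ℕ // IsMonomialExponent E a}) :
    B.koszulBasis m p = B.koszulMonomial m p.2.1 p.1.1 := by
  rw [koszulMonomial, koszulSingle_of p.1.2, extendExponent_of _ p.2.2, koszulBasis,
    Finsupp.coe_basis]

lemma koszul_ext {m : ℕ} {M : Type*} [AddCommGroup M] [Module k M]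
    {f f' : (KoszulIndex E m →₀ A) →ₗ[k] M}
    (h : ∀ a c, IsMonomialExponent E a → IsKoszulExponent E m c →
      f (B.koszulMonomial m a c) = f' (B.koszulMonomial m a c)) : f = f' :=
  (B.koszulBasis m).ext fun p => by
    rw [koszulBasis_apply]
    exact h _ _ p.2.2 p.1.2

lemma sum_sum_eq_zero_of_antisymm {M : Type*} [AddCommGroup M] [Module k M]
    (hk2 : (2 : k) ≠ 0) {ι : Type*} [Fintype ι] {T : ι → ι → M} (h : ∀ i j, T i j = -T j i) :
    ∑ i, ∑ j, T i j = 0 := by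
  refine eq_zero_of_eq_neg_one_smul hk2 ?_
  rw [neg_one_smul]
  conv_lhs => rw [Finset.sum_comm]
  simp only [← Finset.sum_neg_distrib]
  exact Finset.sum_congr rfl fun i _ => Finset.sum_congr rfl fun j _ => h j i

lemma koszulD_koszulD (hk2 : (2 : k) ≠ 0) (hE : ∀ i j, E i j * E j i = 1) (m : ℕ) :
    B.koszulD (m + 1) m ∘ₗ B.koszulD (m + 2) (m + 1) = 0 := by
  suffices h : (B.koszulD (m + 1) m).restrictScalars k ∘ₗ
      (B.koszulD (m + 2) (m + 1)).restrictScalars k = 0 from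
    LinearMap.ext fun z => LinearMap.congr_fun h z
  refine B.koszul_ext fun a c _ hc => ?_
  have hd : ∀ j, 0 < c j → IsKoszulExponent E (m + 1) (c - Pi.single j 1) := fun j hj => by
    obtain ⟨c, rfl⟩ := exists_eq_add_single hj
    rw [add_tsub_cancel_right]
    exact isKoszulExponent_of_add_single hc
  simp only [LinearMap.comp_apply, LinearMap.restrictScalars_apply, LinearMap.zero_apply]
  rw [B.koszulD_koszulMonomial _ _ hc, map_sum]
  -- `T j i` is the term of `d²` that removes `j` first and `i` second.
  set T : Fin n → Fin n → (KoszulIndex E m →₀ A) := fun j i =>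
    if 0 < c j then if 0 < (c - Pi.single j 1 : Fin n → ℕ) i then
      (koszulCoeff E j a c * koszulCoeff E i (a + Pi.single j 1) (c - Pi.single j 1)) •
        B.koszulMonomial m (a + Pi.single j 1 + Pi.single i 1)
          (c - Pi.single j 1 - Pi.single i 1) else 0 else 0 with hT
  -- Removing `i` twice requires `c i ≥ 2`, hence `E i i = -1`, and then `x i ^ 2 = 0`.
  have hT0 : ∀ i, T i i = 0 := fun i => by
    rw [hT]
    dsimp only
    split_ifs with h1 h2
    · have hi : E i i = -1 := by
        by_contra hi
        have := hc.1 i hi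
        simp at h2
        omega
      rw [koszulMonomial_of_not_left _ (not_isMonomialExponent_add hi a), smul_zero]
    · rfl
    · rfl
  calc _ = ∑ j, ∑ i, T j i := Finset.sum_congr rfl fun j _ => ?_
    _ = 0 := sum_sum_eq_zero_of_antisymm hk2 fun j i => ?_
  · by_cases hj : 0 < c j
    · simp only [hT, if_pos hj]
      rw [LinearMap.map_smul_of_tower, B.koszulD_koszulMonomial _ _ (hd j hj), Finset.smul_sum]
      refine Finset.sum_congr rfl fun i _ => ?_
      rw [smul_ite, smul_smul, smul_zero]
    · simp [hT, hj]
  · by_cases hij : i = j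
    · rw [hij, hT0, neg_zero]
    · by_cases hj : 0 < c j
      · obtain ⟨c', rfl⟩ := exists_eq_add_single hj
        by_cases hi : 0 < c' i
        · obtain ⟨c, rfl⟩ := exists_eq_add_single hi
          simp only [hT, add_tsub_cancel_right]
          rw [add_right_comm c, add_tsub_cancel_right, add_right_comm a]
          simp only [Pi.add_apply, Pi.single_eq_same, if_true, lt_add_iff_pos_left,
            add_pos_iff, zero_lt_one, or_true, true_or, add_tsub_cancel_right]
          rw [koszulCoeff_mul_add hE hij, neg_smul]
        · simp [hT, hi, hij]
      · have hji : j ≠ i := fun h => hij h.symm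
        simp [hT, hj, hji]

open Classical in
/-- The contracting homotopy of the Koszul complex: it integrates along one variable that occurs
in the multidegree. -/
def koszulHomotopy (m m' : ℕ) : (KoszulIndex E m →₀ A) →ₗ[k] (KoszulIndex E m' →₀ A) :=
  (B.koszulBasis m).constr k fun p =>
    if h : ∃ i, (p.2.1 + p.1.1) i ≠ 0 then
      if 0 < p.2.1 h.choose then
        (koszulCoeff E h.choose (p.2.1 - Pi.single h.choose 1)
          (p.1.1 + Pi.single h.choose 1))⁻¹ •
        B.koszulMonomial m' (p.2.1 - Pi.single h.choose 1) (p.1.1 + Pi.single h.choose 1)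
      else 0
    else 0

/-- The variable of integration depends only on the multidegree `a + c`, so the same `i` governs
both terms of `dh + hd`. -/
lemma exists_koszulHomotopy_koszulMonomial {w : Fin n → ℕ} (hw : w ≠ 0) :
    ∃ i, w i ≠ 0 ∧ ∀ m m' a c, IsMonomialExponent E a → IsKoszulExponent E m c → a + c = w →
      B.koszulHomotopy m m' (B.koszulMonomial m a c) = if 0 < a i then
        (koszulCoeff E i (a - Pi.single i 1) (c + Pi.single i 1))⁻¹ •
          B.koszulMonomial m' (a - Pi.single i 1) (c + Pi.single i 1) else 0 := by
  have h : ∃ i, w i ≠ 0 := Function.ne_iff.1 hw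
  refine ⟨h.choose, h.choose_spec, fun m m' a c ha hc hac => ?_⟩
  subst hac
  have := B.koszulBasis_apply m ⟨⟨c, hc⟩, ⟨a, ha⟩⟩
  dsimp only at this
  rw [← this, koszulHomotopy, Module.Basis.constr_basis, dif_pos h]

/-- For `w = a + c`, the pair `(a i, c i)` is `(w i, 0)` or `(w i - 1, 1)` if `E i i ≠ -1`, and `(1,
w i - 1)` or `(0, w i)` otherwise. In direction `i` the differential sends the first to the second
with invertible coefficient and `h` inverts this; the other directions cancel. If `m = 0`, then `c =
0` and the outgoing differential vanishes for any `m'`. -/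
lemma koszulD_koszulHomotopy_add (hE : ∀ i j, E i j * E j i = 1) {m m' : ℕ}
    (hm : m = m' + 1 ∨ m = 0) {a c : Fin n → ℕ} (ha : IsMonomialExponent E a)
    (hc : IsKoszulExponent E m c) (hac : a + c ≠ 0) :
    B.koszulD (m + 1) m (B.koszulHomotopy m (m + 1) (B.koszulMonomial m a c)) +
      B.koszulHomotopy m' m (B.koszulD m m' (B.koszulMonomial m a c)) =
        B.koszulMonomial m a c := by
  classical
  obtain ⟨i, hi, hH⟩ := B.exists_koszulHomotopy_koszulMonomial hac
  have hm' : ∀ j, 0 < c j → m = m' + 1 := fun j hj => hm.resolve_right fun h => by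
    have := Finset.sum_eq_zero_iff.1 (hc.2.trans h) j (Finset.mem_univ j)
    omega
  rw [hH m (m + 1) a c ha hc rfl, B.koszulD_koszulMonomial m' a hc, map_sum]
  have hterm : ∀ (r : k) (j : Fin n) (c' : Fin n → ℕ), c = c' + Pi.single j 1 →
      B.koszulHomotopy m' m (r •
        B.koszulMonomial m' (a + Pi.single j 1) c') =
      if IsMonomialExponent E (a + Pi.single j 1) ∧ 0 < (a + Pi.single j 1 : Fin n → ℕ) i then
        (r * (koszulCoeff E i (a + Pi.single j 1 - Pi.single i 1) (c' + Pi.single i 1))⁻¹) •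
          B.koszulMonomial m (a + Pi.single j 1 - Pi.single i 1) (c' + Pi.single i 1) else 0 := by
    rintro r j c' rfl
    have hc' : IsKoszulExponent E m' c' := by
      obtain rfl := hm' j (by simp)
      exact isKoszulExponent_of_add_single hc
    by_cases haj : IsMonomialExponent E (a + Pi.single j 1)
    · rw [map_smul, hH m' m _ _ haj hc' (by rw [add_assoc, add_comm (Pi.single j 1)])]
      simp only [haj, true_and, smul_ite, smul_smul, smul_zero]
    · rw [koszulMonomial_of_not_left _ haj, smul_zero, map_zero, if_neg (fun h => haj h.1)]
  -- In direction `i` the monomial is either a source, and `dh` returns it, or a target, and then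
  -- `h` kills it and `hd` returns it.
  by_cases hcase : 0 < a i ∧ IsKoszulExponent E (m + 1) (c + Pi.single i 1)
  · obtain ⟨hai, hci⟩ := hcase
    obtain ⟨a, rfl⟩ := exists_eq_add_single hai
    rw [if_pos hai, add_tsub_cancel_right, LinearMap.map_smul_of_tower,
      B.koszulD_koszulMonomial m a hci, Finset.smul_sum, ← Finset.sum_add_distrib,
      Finset.sum_eq_single i]
    · rw [if_pos (by simp), add_tsub_cancel_right, inv_smul_smul₀ (koszulCoeff_ne_zero hE _ _ _)]
      convert add_zero _
      split_ifs with h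
      · have hEi : E i i = -1 := by
          by_contra hi'
          have := hci.1 i hi'
          simp at this
          omega
        rw [koszulMonomial_of_not_left _ (not_isMonomialExponent_add hEi a), smul_zero, map_zero]
      · rw [map_zero]
    · intro j _ hji
      by_cases hj : 0 < c j
      · obtain ⟨c, rfl⟩ := exists_eq_add_single hj
        rw [if_pos (by simp), if_pos hj, add_tsub_cancel_right, hterm _ j c rfl,
          add_right_comm c, add_tsub_cancel_right, add_right_comm a, add_tsub_cancel_right]
        by_cases haj : IsMonomialExponent E (a + Pi.single j 1)
        · rw [if_pos, smul_smul, ← add_smul]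
          · convert zero_smul k _
            have h1 := koszulCoeff_ne_zero hE i a (c + Pi.single i 1 + Pi.single j 1)
            have h2 := koszulCoeff_ne_zero hE i (a + Pi.single j 1) (c + Pi.single i 1)
            have h3 := koszulCoeff_mul_add hE hji a c
            field_simp
            linear_combination h3
          · refine ⟨?_, by simp⟩
            have := isMonomialExponent_add_single (i := i) haj (fun hEi => ?_)
            · exact this
            · have := ha i hEi
              simp [Ne.symm hji] at this ⊢
              omega
        · rw [koszulMonomial_of_not_left _ haj, smul_zero, smul_zero, smul_zero,
            ite_self, add_zero]
      · simp [hj, hji]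
    · simp
  · have h1 : 0 < c i ∧ IsMonomialExponent E (a + Pi.single i 1) ∧ (E i i = -1 → a i = 0) := by
      by_cases hEi : E i i = -1
      · have h0 : a i = 0 := by
          by_contra h
          exact hcase ⟨Nat.pos_of_ne_zero h,
            isKoszulExponent_succ_add_single hc fun h' => (h' hEi).elim⟩
        refine ⟨Nat.pos_of_ne_zero fun h => hi (by simp [h0, h]),
          isMonomialExponent_add_single ha fun _ => h0, fun _ => h0⟩
      · refine ⟨Nat.pos_of_ne_zero fun h => ?_,
          isMonomialExponent_add_single ha fun h' => (hEi h').elim, fun h' => (hEi h').elim⟩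
        refine hcase ⟨Nat.pos_of_ne_zero fun h' => hi (by simp [h, h']),
          isKoszulExponent_succ_add_single hc fun _ => h⟩
    obtain ⟨hci, hai, hai'⟩ := h1
    obtain ⟨c, rfl⟩ := exists_eq_add_single hci
    have hfirst : (if 0 < a i then (koszulCoeff E i (a - Pi.single i 1)
        (c + Pi.single i 1 + Pi.single i 1))⁻¹ • B.koszulMonomial (m + 1) (a - Pi.single i 1)
          (c + Pi.single i 1 + Pi.single i 1) else 0) = 0 := by
      split_ifs with h
      · rw [koszulMonomial_of_not_right _ fun h' => hcase ⟨h, h'⟩, smul_zero]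
      · rfl
    rw [hfirst, map_zero, zero_add, Finset.sum_eq_single i]
    · rw [if_pos hci, add_tsub_cancel_right, hterm _ i c rfl, if_pos ⟨hai, by simp⟩,
        add_tsub_cancel_right, mul_inv_cancel₀ (koszulCoeff_ne_zero hE _ _ _), one_smul]
    · intro j _ hji
      by_cases hj : 0 < c j
      · obtain ⟨c, rfl⟩ := exists_eq_add_single hj
        rw [if_pos (by simp), add_right_comm c, add_tsub_cancel_right, hterm _ j _ (add_right_comm _ _ _)]
        split_ifs with h
        -- Here `a i > 0`, which excludes `E i i = -1`; the resulting generator would have exponent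
        -- at least 2 at `i` and is therefore zero.
        · have hEi : E i i ≠ -1 := fun hEi => by
            have := h.2
            simp [Ne.symm hji, hai' hEi] at this
          rw [koszulMonomial_of_not_right, smul_zero]
          intro h'
          have := h'.1 i hEi
          simp at this
        · rfl
      · simp [hj, hji]
    · simp

end SkewPolynomialBasis

/-! ### Tensor products with the trivial module -/

section BalancedTensor

variable {k : Type u} [Field k] {A : Type v} [Ring A] [Algebra k A] (aug : A →ₐ[k] k)
  {N : Type*} [AddCommGroup N] [Module k N] [Module A N]

lemma balancedTensor_mk_smul (m : TrivialModule aug) (a : A) (z : N) :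
    (Submodule.Quotient.mk (m ⊗ₜ[k] (a • z)) : BalancedTensor k A (TrivialModule aug) N) =
      aug a • Submodule.Quotient.mk (m ⊗ₜ[k] z) := by
  have h : MulOpposite.op a • m = aug a • m := rfl
  rw [← Submodule.Quotient.mk_smul, TensorProduct.smul_tmul', ← h, eq_comm,
    Submodule.Quotient.eq]
  exact Submodule.subset_span ⟨m, a, z, rfl⟩

variable [IsScalarTower k A N]

/-- An element of the augmentation ideal can be moved across the tensor sign, where it acts by zero.
-/
lemma BalancedTensor.map_eq_zero {N' : Type*} [AddCommGroup N'] [Module k N'] [Module A N']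
    [IsScalarTower k A N'] (f : N →ₗ[A] N')
    (hf : ∀ z, f z ∈ Submodule.span A {y : N' | ∃ a z', aug a = 0 ∧ y = a • z'}) :
    BalancedTensor.map k A (TrivialModule aug) f = 0 := by
  refine Submodule.linearMap_qext _ (TensorProduct.ext' fun m z => ?_)
  change (Submodule.Quotient.mk (m ⊗ₜ[k] f z) : BalancedTensor k A (TrivialModule aug) N') = 0
  refine Submodule.span_induction
    (p := fun y _ => (Submodule.Quotient.mk (m ⊗ₜ[k] y) :
      BalancedTensor k A (TrivialModule aug) N') = 0) ?_ ?_ ?_ ?_ (hf z)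
  · rintro _ ⟨a, z', ha, rfl⟩
    rw [balancedTensor_mk_smul, ha, zero_smul]
  · rw [TensorProduct.tmul_zero, Submodule.Quotient.mk_zero]
  · intro y y' _ _ hy hy'
    rw [TensorProduct.tmul_add, Submodule.Quotient.mk_add, hy, hy', add_zero]
  · intro a y _ hy
    rw [balancedTensor_mk_smul, hy, smul_zero]

/-- The tensor product of the trivial module with a free module. -/
def balancedTensorFreeEquiv {C : Type*} (e : N ≃ₗ[A] (C →₀ A)) :
    BalancedTensor k A (TrivialModule aug) N ≃ₗ[k] (C →₀ k) := by
  let φ : N →ₗ[k] (C →₀ k) :=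
    Finsupp.mapRange.linearMap aug.toLinearMap ∘ₗ (e.restrictScalars k).toLinearMap
  have hφ : ∀ (a : A) (z : N), φ (a • z) = aug a • φ z := fun a z => by
    ext c
    simp [φ]
  let ψ : TrivialModule aug →ₗ[k] N →ₗ[k] (C →₀ k) := LinearMap.toSpanSingleton k _ φ
  have hψ : ∀ m z, ψ m z = (show k from m) • φ z := fun _ _ => rfl
  let F : BalancedTensor k A (TrivialModule aug) N →ₗ[k] (C →₀ k) :=
    Submodule.liftQ _ (TensorProduct.lift ψ) <| by
      rw [balancedRelations, Submodule.span_le]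
      rintro _ ⟨m, a, z, rfl⟩
      rw [SetLike.mem_coe, LinearMap.mem_ker, map_sub, TensorProduct.lift.tmul,
        TensorProduct.lift.tmul, hψ, hψ, hφ, smul_smul, sub_eq_zero, mul_comm]
      rfl
  let one : TrivialModule aug := (1 : k)
  let G : (C →₀ k) →ₗ[k] BalancedTensor k A (TrivialModule aug) N :=
    Finsupp.linearCombination k fun c =>
      Submodule.Quotient.mk (one ⊗ₜ[k] e.symm (Finsupp.single c 1))
  refine LinearEquiv.ofLinearMap F G ?_ ?_
  · ext c : 2
    change F (G (Finsupp.single c 1)) = Finsupp.single c 1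
    rw [Finsupp.linearCombination_single, one_smul]
    change (1 : k) • φ _ = _
    simp [φ]
  · refine Submodule.linearMap_qext _ (TensorProduct.ext' fun m z => ?_)
    suffices h : ∀ (r : k) (z : N), G (r • φ z) = Submodule.Quotient.mk ((r • one) ⊗ₜ[k] z) by
      have hm : (show k from m) • one = m := mul_one (show k from m)
      exact (h m z).trans (by rw [hm]; rfl)
    intro r z
    obtain ⟨f, rfl⟩ := e.symm.surjective z
    induction f using Finsupp.induction_linear with
    | zero => simp
    | add f f' hf hf' =>
      rw [map_add, map_add, smul_add, map_add, hf, hf', TensorProduct.tmul_add,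
        Submodule.Quotient.mk_add]
    | single c u =>
      have hu : e.symm (Finsupp.single c u) = u • e.symm (Finsupp.single c 1) := by
        rw [← map_smul, Finsupp.smul_single, smul_eq_mul, mul_one]
      have h1 : φ (e.symm (Finsupp.single c 1)) = Finsupp.single c 1 := by simp [φ]
      rw [hu, hφ, h1, balancedTensor_mk_smul, smul_comm, map_smul, map_smul,
        Finsupp.linearCombination_single, one_smul, ← TensorProduct.smul_tmul',
        Submodule.Quotient.mk_smul]

end BalancedTensor

/-! ### The Koszul resolution of the trivial module and its `Tor` -/

namespace SkewPolynomialBasis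

variable {k : Type u} [Field k] {n : ℕ} {E : Fin n → Fin n → k} {A : Type u} [Ring A]
  [Algebra k A] (B : SkewPolynomialBasis E A) (aug : A →ₐ[k] k)

lemma isKoszulExponent_zero : IsKoszulExponent E 0 0 := ⟨fun _ _ => zero_le_one, by simp⟩

lemma IsKoszulExponent.eq_zero {c : Fin n → ℕ} (hc : IsKoszulExponent E 0 c) : c = 0 :=
  funext fun i => Finset.sum_eq_zero_iff.1 hc.2 i (Finset.mem_univ i)

lemma aug_extendExponent (hE : ∀ i j, E i j * E j i = 1) (haug : ∀ i, aug (B.x i) = 0)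
    {a : Fin n → ℕ} (ha : a ≠ 0) : aug (extendExponent B.basis a) = 0 := by
  obtain ⟨i, hi⟩ := Function.ne_iff.1 ha
  obtain ⟨a, rfl⟩ := exists_eq_add_single (Nat.pos_of_ne_zero hi)
  have h := congrArg aug (B.extend_mul_x a i)
  rw [map_mul, haug, mul_zero, map_smul, eq_comm, smul_eq_zero] at h
  exact h.resolve_left (powProd_ne_zero (passRight_ne_zero hE i) a)

variable (E) in
/-- The augmentation of the Koszul complex. -/
def koszulAug : (KoszulIndex E 0 →₀ A) →ₗ[A] TrivialModule aug :=
  Finsupp.linearCombination A fun _ => (show TrivialModule aug from (1 : k))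

lemma koszulAug_single (c : KoszulIndex E 0) (u : A) :
    koszulAug E aug (Finsupp.single c u) = aug u := by
  rw [koszulAug, Finsupp.linearCombination_single]
  exact mul_one (aug u)

lemma koszulAug_surjective : Function.Surjective (koszulAug E (A := A) aug) := fun r =>
  ⟨Finsupp.single ⟨0, isKoszulExponent_zero⟩ (algebraMap k A r), by
    rw [koszulAug_single]
    exact aug.commutes r⟩

lemma koszulAug_koszulD (haug : ∀ i, aug (B.x i) = 0) :
    koszulAug E aug ∘ₗ B.koszulD 1 0 = 0 := by
  refine Finsupp.lhom_ext' fun c => LinearMap.ext_ring ?_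
  simp only [LinearMap.comp_apply, Finsupp.lsingle_apply, koszulD,
    Finsupp.linearCombination_single, one_smul, map_sum, LinearMap.zero_apply]
  refine Finset.sum_eq_zero fun i _ => ?_
  split_ifs
  · by_cases h : IsKoszulExponent E 0 (c.1 - Pi.single i 1)
    · rw [koszulSingle_of h, koszulAug_single, map_smul, haug, smul_zero]
      rfl
    · rw [koszulSingle_of_not h, LinearMap.zero_apply, map_zero]
  · rw [map_zero]

/-- In positive homological degree `c ≠ 0`, so no basis monomial has multidegree zero and the
homotopy identity holds everywhere. -/
lemma exists_koszulD_eq (hE : ∀ i j, E i j * E j i = 1) (m : ℕ) (z : KoszulIndex E (m + 1) →₀ A)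
    (hz : B.koszulD (m + 1) m z = 0) : ∃ y, B.koszulD (m + 2) (m + 1) y = z := by
  have h : (B.koszulD (m + 2) (m + 1)).restrictScalars k ∘ₗ B.koszulHomotopy (m + 1) (m + 2) +
      B.koszulHomotopy m (m + 1) ∘ₗ (B.koszulD (m + 1) m).restrictScalars k = LinearMap.id :=
    B.koszul_ext fun a c ha hc =>
      B.koszulD_koszulHomotopy_add hE (Or.inl rfl) ha hc fun h => by
        have := hc.2
        rw [(add_eq_zero.1 h).2] at this
        simp at this
  have hz' := LinearMap.congr_fun h z
  simp only [LinearMap.add_apply, LinearMap.comp_apply, LinearMap.restrictScalars_apply, hz,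
    map_zero, add_zero, LinearMap.id_apply] at hz'
  exact ⟨_, hz'⟩

lemma exists_koszulD_eq_zero (hE : ∀ i j, E i j * E j i = 1) (haug : ∀ i, aug (B.x i) = 0)
    (z : KoszulIndex E 0 →₀ A) (hz : koszulAug E aug z = 0) : ∃ y, B.koszulD 1 0 y = z := by
  let τ : (KoszulIndex E 0 →₀ A) →ₗ[k] k :=
    { toFun := fun z => koszulAug E aug z
      map_add' := fun y z => map_add (koszulAug E aug) y z
      map_smul' := fun r z => by
        induction z using Finsupp.induction_linear with
        | zero => rw [smul_zero, map_zero]; exact (mul_zero r).symm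
        | add y z hy hz => rw [smul_add, map_add, hy, hz, map_add]; exact (mul_add r _ _).symm
        | single c u => rw [Finsupp.smul_single, koszulAug_single, koszulAug_single, map_smul]; rfl }
  -- In degree 0 the monomial `1` is the only one of multidegree zero. The homotopy kills it, and
  -- the projection through `τ` restores it; `τ` kills all other monomials.
  have h : (B.koszulD 1 0).restrictScalars k ∘ₗ B.koszulHomotopy 0 1 +
      LinearMap.toSpanSingleton k _ (B.koszulMonomial 0 0 0) ∘ₗ τ = LinearMap.id := by
    refine B.koszul_ext fun a c ha hc => ?_
    obtain rfl := IsKoszulExponent.eq_zero hc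
    simp only [LinearMap.add_apply, LinearMap.comp_apply, LinearMap.restrictScalars_apply,
      LinearMap.toSpanSingleton_apply, LinearMap.id_apply]
    have hτ : τ (B.koszulMonomial 0 a 0) = aug (extendExponent B.basis a) := by
      rw [koszulMonomial, koszulSingle_of hc]
      exact koszulAug_single aug _ _
    rw [hτ]
    by_cases h0 : a = 0
    · subst h0
      have hH : B.koszulHomotopy 0 1 (B.koszulMonomial 0 0 0) = 0 := by
        have := B.koszulBasis_apply 0 ⟨⟨0, hc⟩, ⟨0, ha⟩⟩
        dsimp only at this
        rw [← this, koszulHomotopy, Module.Basis.constr_basis, dif_neg (by simp)]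
      rw [hH, map_zero, zero_add, B.extend_zero, map_one, one_smul]
    · have := B.koszulD_koszulHomotopy_add hE (m' := 0) (Or.inr rfl) ha hc
        (fun h => h0 (add_eq_zero.1 h).1)
      rw [B.koszulD_koszulMonomial 0 a hc] at this
      rw [B.aug_extendExponent aug hE haug h0, zero_smul, add_zero]
      simpa using this
  have hz' := LinearMap.congr_fun h z
  simp only [LinearMap.add_apply, LinearMap.comp_apply, LinearMap.restrictScalars_apply,
    LinearMap.id_apply] at hz'
  rw [show τ z = 0 from hz, map_zero, add_zero] at hz'
  exact ⟨_, hz'⟩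

/-- The Koszul complex. -/
def koszulComplex (hk2 : (2 : k) ≠ 0) (hE : ∀ i j, E i j * E j i = 1) :
    ChainComplex (ModuleCat.{u} A) ℕ :=
  ChainComplex.of (fun m => ModuleCat.of A (KoszulIndex E m →₀ A))
    (fun m => ModuleCat.ofHom (B.koszulD (m + 1) m)) fun m =>
      ModuleCat.hom_ext (B.koszulD_koszulD hk2 hE m)

lemma koszulComplex_d (hk2 : (2 : k) ≠ 0) (hE : ∀ i j, E i j * E j i = 1) (m : ℕ) :
    (B.koszulComplex hk2 hE).d (m + 1) m = ModuleCat.ofHom (B.koszulD (m + 1) m) :=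
  ChainComplex.of_d (fun m => ModuleCat.of A (KoszulIndex E m →₀ A))
    (fun m => ModuleCat.ofHom (B.koszulD (m + 1) m)) m

/-- The Koszul resolution of the trivial module. -/
def koszulResolution (hk2 : (2 : k) ≠ 0) (hE : ∀ i j, E i j * E j i = 1)
    (haug : ∀ i, aug (B.x i) = 0) :
    ProjectiveResolution (ModuleCat.of A (TrivialModule aug)) where
  complex := B.koszulComplex hk2 hE
  projective m := ModuleCat.projective_of_free (Finsupp.basisSingleOne (R := A))
  π := (ChainComplex.toSingle₀Equiv _ _).symm ⟨ModuleCat.ofHom (koszulAug E aug), by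
    rw [koszulComplex_d]
    exact ModuleCat.hom_ext (B.koszulAug_koszulD aug haug)⟩
  quasiIso := ⟨fun m => by
    cases m with
    | zero =>
      -- In degree 0 the claim amounts to exactness at the degree-0 term of the augmented complex
      -- and surjectivity of the augmentation.
      rw [ChainComplex.quasiIsoAt₀_iff, ShortComplex.quasiIso_iff_of_zeros']
      · have hw : ModuleCat.ofHom (B.koszulD 1 0) ≫ ModuleCat.ofHom (koszulAug E aug) = 0 :=
          ModuleCat.hom_ext (B.koszulAug_koszulD aug haug)
        refine (ShortComplex.exact_and_epi_g_iff_of_iso (S₁ := ShortComplex.mk _ _ hw) ?_).1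
          ⟨?_, ?_⟩
        · refine ShortComplex.isoMk (Iso.refl _) (Iso.refl _) (Iso.refl _)
            ?_ ?_
          · refine (Category.id_comp _).trans (Eq.trans ?_ (Category.comp_id _).symm)
            exact B.koszulComplex_d hk2 hE 0
          · refine (Category.id_comp _).trans (Eq.trans ?_ (Category.comp_id _).symm)
            exact ChainComplex.toSingle₀Equiv_symm_apply_f_zero _ _
        · rw [ShortComplex.moduleCat_exact_iff]
          exact fun z hz => B.exists_koszulD_eq_zero aug hE haug z hz
        · exact (ModuleCat.epi_iff_surjective _).2 (koszulAug_surjective aug)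
      all_goals rfl
    | succ m =>
      rw [quasiIsoAt_iff_exactAt']
      · rw [HomologicalComplex.exactAt_iff' _ (m + 2) (m + 1) m (by simp) (by simp),
          ShortComplex.moduleCat_exact_iff]
        intro z hz
        obtain ⟨y, hy⟩ := B.exists_koszulD_eq hE m z (by
          change (B.koszulComplex hk2 hE).d (m + 1) m z = 0 at hz
          rwa [koszulComplex_d] at hz)
        refine ⟨y, ?_⟩
        change (B.koszulComplex hk2 hE).d (m + 2) (m + 1) y = z
        rw [koszulComplex_d]
        exact hy
      · apply ChainComplex.exactAt_succ_single_obj⟩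

/-- Minimality: the coefficients of the differential are scalar multiples of generators, which the
augmentation kills. -/
lemma koszulD_mem_span (haug : ∀ i, aug (B.x i) = 0) (m m' : ℕ) (z : KoszulIndex E m →₀ A) :
    B.koszulD m m' z ∈
      Submodule.span A {y : KoszulIndex E m' →₀ A | ∃ a z', aug a = 0 ∧ y = a • z'} := by
  rw [koszulD, Finsupp.linearCombination_apply, Finsupp.sum]
  refine Submodule.sum_mem _ fun c _ => Submodule.smul_mem _ _ (Submodule.sum_mem _ fun i _ => ?_)
  split_ifs
  · refine Submodule.subset_span ⟨powProd (passLeft E i) c.1 • B.x i,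
      koszulSingle E A m' (c.1 - Pi.single i 1) 1, by rw [map_smul, haug, smul_zero], ?_⟩
    rw [← map_smul, smul_eq_mul, mul_one]
  · exact Submodule.zero_mem _

/-- The tensor product of the trivial module with a free object of the category of modules. -/
def _root_.balancedTensorFunctorFreeEquiv {C : Type*} (N : ModuleCat.{u} A)
    (e : N ≃ₗ[A] (C →₀ A)) :
    (balancedTensorFunctor k A (TrivialModule aug)).obj N ≃ₗ[k] (C →₀ k) :=
  balancedTensorFreeEquiv aug e

/-- `Tor` over a skew polynomial algebra of the trivial modules. -/
def algebraTorEquiv (hk2 : (2 : k) ≠ 0) (hE : ∀ i j, E i j * E j i = 1)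
    (haug : ∀ i, aug (B.x i) = 0) (m : ℕ) :
    algebraTor k A (TrivialModule aug) m (ModuleCat.of A (TrivialModule aug)) ≃ₗ[k]
      (KoszulIndex E m →₀ k) := by
  let F := balancedTensorFunctor k A (TrivialModule aug)
  let P := B.koszulResolution aug hk2 hE haug
  let K := (F.mapHomologicalComplex _).obj P.complex
  -- By minimality the tensored complex has zero differential, so its homology is the complex
  -- itself.
  have hd : ∀ i j, K.d i j = 0 := fun i j => by
    by_cases hij : j + 1 = i
    · subst hij
      change F.map ((B.koszulComplex hk2 hE).d (j + 1) j) = 0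
      rw [koszulComplex_d]
      exact ModuleCat.hom_ext (BalancedTensor.map_eq_zero aug _
        (B.koszulD_mem_span aug haug (j + 1) j))
    · exact K.shape _ _ hij
  let e₁ : algebraTor k A (TrivialModule aug) m (ModuleCat.of A (TrivialModule aug)) ≅
      K.homology m := P.isoLeftDerivedObj F m
  let e₂ : K.homology m ≅ F.obj (ModuleCat.of A (KoszulIndex E m →₀ A)) :=
    (ShortComplex.LeftHomologyData.ofZeros (K.sc m) (hd _ _) (hd _ _)).homologyIso
  exact (e₁ ≪≫ e₂).toLinearEquiv.trans
    (balancedTensorFunctorFreeEquiv aug (ModuleCat.of A (KoszulIndex E m →₀ A))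
      (LinearEquiv.refl A (KoszulIndex E m →₀ A)))

end SkewPolynomialBasis

/-! ### Counting the generators of the Koszul complex -/

section Counting

variable {k : Type u} [Field k] {n : ℕ} (E : Fin n → Fin n → k)

open Classical in
/-- Koszul exponents as a finite set of finitely supported functions. -/
def koszulIndexEquiv (m : ℕ) : KoszulIndex E m ≃
    {l // l ∈ (Finset.finsuppAntidiag Finset.univ m).filter
      fun l : Fin n →₀ ℕ => ∀ i, E i i ≠ -1 → l i ≤ 1} :=
  (Finsupp.equivFunOnFinite.subtypeEquiv fun l => by
    simp [IsKoszulExponent, Finset.mem_finsuppAntidiag, and_comm]).symm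

instance (m : ℕ) : Finite (KoszulIndex E m) :=
  Finite.of_equiv _ (koszulIndexEquiv E m).symm

-- The conditions on the `c i` are independent, so the series factors over the variables: a free
-- exponent contributes `1/(1 - X)`, an exponent bounded by 1 contributes `1 + X`.
open Classical in
lemma mk_card_koszulIndex :
    (PowerSeries.mk fun m => (Nat.card (KoszulIndex E m) : ℚ)) =
      (1 + PowerSeries.X) ^ (n - Nat.card {i // E i i = -1}) *
        ((1 - PowerSeries.X) ^ Nat.card {i // E i i = -1})⁻¹ := by
  have hcoeff : ∀ (i : Fin n) (j : ℕ), PowerSeries.coeff j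
      (if E i i = -1 then (1 - PowerSeries.X)⁻¹ else 1 + PowerSeries.X : PowerSeries ℚ) =
        if E i i ≠ -1 → j ≤ 1 then 1 else 0 := by
    intro i j
    by_cases h : E i i = -1
    · have : ((1 - PowerSeries.X)⁻¹ : PowerSeries ℚ) = PowerSeries.mk 1 := by
        rw [PowerSeries.inv_eq_iff_mul_eq_one (by simp), PowerSeries.mk_one_mul_one_sub_eq_one]
      simp [h, this]
    · rcases j with _ | _ | j <;> simp [h, PowerSeries.coeff_one, PowerSeries.coeff_X]
  have hprod : (PowerSeries.mk fun m => (Nat.card (KoszulIndex E m) : ℚ)) =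
      ∏ i : Fin n,
        (if E i i = -1 then (1 - PowerSeries.X)⁻¹ else 1 + PowerSeries.X : PowerSeries ℚ) := by
    ext m
    rw [PowerSeries.coeff_mk, PowerSeries.coeff_prod, Nat.card_congr (koszulIndexEquiv E m),
      Nat.card_eq_fintype_card, Fintype.card_coe, Finset.card_filter, Nat.cast_sum]
    refine Finset.sum_congr rfl fun l _ => ?_
    simp only [hcoeff]
    rw [Finset.prod_ite_zero]
    simp
  have hcard : Nat.card {i // E i i = -1} = (Finset.univ.filter fun i => E i i = -1).card := by
    rw [Nat.card_eq_fintype_card, Fintype.card_subtype]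
  have hcard' : n - Nat.card {i // E i i = -1} =
      (Finset.univ.filter fun i => ¬ E i i = -1).card := by
    have := Finset.card_filter_add_card_filter_not (s := Finset.univ) (fun i => E i i = -1)
    rw [Finset.card_univ, Fintype.card_fin] at this
    omega
  have hinv : (((1 - PowerSeries.X) ^ Nat.card {i // E i i = -1})⁻¹ : PowerSeries ℚ) =
      (1 - PowerSeries.X)⁻¹ ^ Nat.card {i // E i i = -1} := by
    rw [PowerSeries.inv_eq_iff_mul_eq_one (by simp), ← mul_pow,
      PowerSeries.inv_mul_cancel _ (by simp), one_pow]
  rw [hprod, Finset.prod_ite, Finset.prod_const, Finset.prod_const, hinv, hcard', hcard, mul_comm]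

lemma isEmpty_koszulIndex (hE : ∀ i, E i i ≠ -1) {m : ℕ} (hm : n < m) :
    IsEmpty (KoszulIndex E m) :=
  ⟨fun c => by
    have : ∑ i, c.1 i ≤ ∑ _i : Fin n, 1 := Finset.sum_le_sum fun i _ => c.2.1 i (hE i)
    rw [c.2.2] at this
    simp at this
    omega⟩

lemma nonempty_koszulIndex {i : Fin n} (hi : E i i = -1) (m : ℕ) :
    Nonempty (KoszulIndex E m) :=
  ⟨⟨Pi.single i m, fun j hj => by
    have : j ≠ i := fun h => hj (h ▸ hi)
    simp [this], by simp⟩⟩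

end Counting

lemma directSum_finite_iff_of_equiv_finsupp {k : Type u} [Field k] {C : ℕ → Type*}
    [∀ m, Finite (C m)] {H : ℕ → Type*} [∀ m, AddCommGroup (H m)] [∀ m, Module k (H m)]
    (e : ∀ m, H m ≃ₗ[k] (C m →₀ k)) :
    Module.Finite k (DirectSum ℕ H) ↔ Finite (Σ m, C m) := by
  have b : Module.Basis (Σ m, C m) k (DirectSum ℕ H) := DFinsupp.basis fun m => .ofRepr (e m)
  exact ⟨fun _ => Module.Finite.finite_basis b, fun _ => Module.Finite.of_basis b⟩

end

theorem mainTheorem4 {k : Type u} [Field k] (hk2 : (2 : k) ≠ 0) (hk3 : (3 : k) ≠ 0)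
    {Γ : Type v} [AddCommGroup Γ] (ε : CommutationFactor k Γ)
    {g : Type u} [AddCommGroup g] [Module k g]
    (L : ColorLieAlgebra ε g) (hL : L.IsAbelian)
    (n : ℕ) (b : Module.Basis (Fin n) k g) (deg : Fin n → Γ)
    (hb : ∀ i, b i ∈ L.component (deg i))
    (q : ℕ) (hq : q = Nat.card {i : Fin n // ε.val (deg i) (deg i) = -1}) :
    (∀ i, Module.Finite k (L.homology i)) ∧
    L.poincareSeries = (1 + PowerSeries.X) ^ (n - q) * ((1 - PowerSeries.X) ^ q)⁻¹ ∧
    (Module.Finite k (DirectSum ℕ fun i => L.homology i) ↔ q = 0) := by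
  let E := ColorLieAlgebra.commutationMatrix ε deg
  let e : ∀ m, L.homology m ≃ₗ[k] (KoszulIndex E m →₀ k) :=
    (ColorLieAlgebra.skewPolynomialBasis hk2 hL b deg hb).algebraTorEquiv L.augmentation hk2
      (ColorLieAlgebra.commutationMatrix_mul_swap ε deg)
      (fun i => L.augmentation_toEnveloping (b i))
  refine ⟨fun m => Module.Finite.equiv (e m).symm, ?_, ?_⟩
  · rw [hq, ColorLieAlgebra.poincareSeries, ← mk_card_koszulIndex E]
    congr 1
    ext m
    rw [(e m).finrank_eq, Module.finrank_eq_nat_card_basis Finsupp.basisSingleOne]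
  · rw [directSum_finite_iff_of_equiv_finsupp e, hq, Finite.card_eq_zero_iff]
    constructor
    · rintro hfin
      refine ⟨fun i => ?_⟩
      -- A single `i` with `E i i = -1` supplies a generator in every degree.
      have : ∀ m, Nonempty (KoszulIndex E m) := nonempty_koszulIndex E i.2
      exact not_finite_iff_infinite.2 (Infinite.of_injective
        (fun m => (⟨m, Classical.arbitrary _⟩ : Σ m, KoszulIndex E m))
        fun m m' h => congrArg Sigma.fst h) hfin
    · intro hempty
      -- If `q = 0`, all `c i ≤ 1`, so only the degrees `0, …, n` occur, each with finitely many
      -- indices.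
      refine Finite.of_injective (β := Σ m : Fin (n + 1), KoszulIndex E m)
        (fun p => ⟨⟨p.1, Nat.lt_succ_of_le (not_lt.1 fun h =>
          (isEmpty_koszulIndex E (fun i hi => hempty.false ⟨i, hi⟩) h).false p.2)⟩, p.2⟩) ?_
      rintro ⟨m, c⟩ ⟨m', c'⟩ h
      simp only [Sigma.mk.injEq, Fin.mk.injEq] at h
      obtain ⟨rfl, h⟩ := h
      rw [eq_of_heq h]
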